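/- Let $q\in\mathbb{C}\setminus\{0\}$ with $q^m\neq 1$ for all $m\in\mathbb{Z}\setminus\{0\}$, and write $[m]=\frac{q^m-q^{-m}}{q-q^{-1}}$. Let $\mathcal{U}_q(\mathfrak{sl}_2)$ be the associative unital $\mathbb{C}$-algebra generated by $K,K^{-1},E,F$ with relations $KK^{-1}=1=K^{-1}K$, $KE=q^2EK$, $KF=q^{-2}FK$, $EF-FE=\frac{1}{q-q^{-1}}(K-K^{-1})$, and coproduct $\Delta(E)=E\otimes K+1\otimes E$, $\Delta(K)=K\otimes K$, $\Delta(F)=F\otimes 1+K^{-1}\otimes F$, through which it acts on tensor products of representations. For $d=s+1\geq 1$ let $\mathsf{M}_d$ be the representation with basis $e_0,\ldots,e_s$ and action $K.e_l=q^{s-2l}e_l$, $F.e_l=e_{l+1}$ (and $F.e_s=0$), $E.e_l=[l][s-l+1]\,e_{l-1}$ (and $E.e_0=0$). For $\varsigma=(s_1,\ldots,s_p)\in\mathbb{Z}_{\geq 0}^p$, $d_i=s_i+1$ and $s\in\mathbb{Z}_{\ge 0}$, let $$\mathsf{H}_\varsigma^{(s)}=\{v\in \mathsf{M}_{d_p}\otimes\cdots\otimes\mathsf{M}_{d_1}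 \,:\, E.v=0,\ K.v=q^s v\},$$ where for $p=0$ the empty tensor product is the trivial representation $\mathbb{C}$. Let $R_+^{(s)}\colon \mathsf{H}_{(\varsigma,s)}^{(0)}\to\mathsf{H}_\varsigma^{(s)}$ be the linear isomorphism sending $v$ to the unique $\tau_0^+\in\mathsf{H}_\varsigma^{(s)}$ with $$v=\sum_{l=0}^s(-1)^{s-l}q^{(l+1)(s-l)}\, e_l\otimes F^{s-l}.\tau_0^+ ,$$ let $R_-^{(s)}\colon \mathsf{H}_{(s,\varsigma)}^{(0)}\to\mathsf{H}_\varsigma^{(s)}$ be the linear isomorphism sending $v$ to the unique $\tau_0^-\in\mathsf{H}_\varsigma^{(s)}$ with $$v=\sum_{l=0}^s(-1)^{s-l}q^{(l-1)(s-l)}\, F^{s-l}.\tau_0^-\otimes e_l ,$$ and let $S^{(s)}=(R_-^{(s)})^{-1}\circ R_+^{(s)}\colon \mathsf{H}_{(\varsigma,s)}^{(0)}\to\mathsf{H}_{(s,\varsigma)}^{(0)}$ be the cyclic permutation map. Then for every $p$ and every $\varsigma=(s_1,\ldots,s_p)\in\mathbb{Z}_{\geq 0}^p$, the composed map $S^{(s_1)}\circ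 S^{(s_2)}\circ\cdots\circ S^{(s_p)}\colon \mathsf{H}_\varsigma^{(0)}\to\mathsf{H}_\varsigma^{(0)}$ (in which $S^{(s_p)}$ is applied first) is a constant multiple of the identity: $$S^{(s_1)}\circ S^{(s_2)}\circ\cdots\circ S^{(s_{p-1})}\circ S^{(s_p)}=\left(\prod_{i=1}^p(-q)^{-s_i}\right)\mathrm{id}_{\mathsf{H}_\varsigma^{(0)}} .$$ -/

import Mathlib

open scoped TensorProduct

namespace QuantumSl2

noncomputable section

/-- The parameter `q` is nonzero and not a root of unity. -/
def Generic (q : ℂ) : Prop := q ≠ 0 ∧ ∀ m : ℤ, m ≠ 0 → q ^ m ≠ 1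

/-- The `q`-integer `[m] = (q^m - q^(-m)) / (q - q^(-1))`. -/
def qnum (q : ℂ) (m : ℤ) : ℂ := (q ^ m - q ^ (-m)) / (q - q⁻¹)

/-! ### The quantum group as an algebra by generators and relations -/

inductive Gen
  | E
  | F
  | K
  | Kinv

/-- The defining relations of the quantum group. -/
inductive Rel (q : ℂ) : FreeAlgebra ℂ Gen → FreeAlgebra ℂ Gen → Prop
  | K_Kinv : Rel q (FreeAlgebra.ι ℂ Gen.K * FreeAlgebra.ι ℂ Gen.Kinv) 1
  | Kinv_K : Rel q (FreeAlgebra.ι ℂ Gen.Kinv * FreeAlgebra.ι ℂ Gen.K) 1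
  | K_E : Rel q (FreeAlgebra.ι ℂ Gen.K * FreeAlgebra.ι ℂ Gen.E)
      ((q ^ 2) • (FreeAlgebra.ι ℂ Gen.E * FreeAlgebra.ι ℂ Gen.K))
  | K_F : Rel q (FreeAlgebra.ι ℂ Gen.K * FreeAlgebra.ι ℂ Gen.F)
      ((q ^ 2)⁻¹ • (FreeAlgebra.ι ℂ Gen.F * FreeAlgebra.ι ℂ Gen.K))
  | E_F : Rel q (FreeAlgebra.ι ℂ Gen.E * FreeAlgebra.ι ℂ Gen.F
        - FreeAlgebra.ι ℂ Gen.F * FreeAlgebra.ι ℂ Gen.E)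
      ((q - q⁻¹)⁻¹ • (FreeAlgebra.ι ℂ Gen.K - FreeAlgebra.ι ℂ Gen.Kinv))

/-- The quantum group `U_q(sl_2)` as an associative unital complex algebra. -/
abbrev Uq (q : ℂ) : Type := RingQuot (Rel q)

/-- The class of a generator in `U_q(sl_2)`. -/
def gen (q : ℂ) (g : Gen) : Uq q := RingQuot.mkAlgHom ℂ (Rel q) (FreeAlgebra.ι ℂ g)

def uE (q : ℂ) : Uq q := gen q Gen.E
def uF (q : ℂ) : Uq q := gen q Gen.F
def uK (q : ℂ) : Uq q := gen q Gen.K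
def uKinv (q : ℂ) : Uq q := gen q Gen.Kinv

theorem uK_uKinv (q : ℂ) : uK q * uKinv q = 1 := by
  have h := RingQuot.mkAlgHom_rel ℂ (Rel.K_Kinv (q := q))
  simpa [uK, uKinv, gen] using h

theorem uKinv_uK (q : ℂ) : uKinv q * uK q = 1 := by
  have h := RingQuot.mkAlgHom_rel ℂ (Rel.Kinv_K (q := q))
  simpa [uK, uKinv, gen] using h

theorem uK_uE (q : ℂ) : uK q * uE q = (q ^ 2) • (uE q * uK q) := by
  have h := RingQuot.mkAlgHom_rel ℂ (Rel.K_E (q := q))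
  simpa only [uK, uE, gen, map_mul, map_smul] using h

theorem uK_uF (q : ℂ) : uK q * uF q = (q ^ 2)⁻¹ • (uF q * uK q) := by
  have h := RingQuot.mkAlgHom_rel ℂ (Rel.K_F (q := q))
  simpa only [uK, uF, gen, map_mul, map_smul] using h

theorem uE_uF (q : ℂ) :
    uE q * uF q - uF q * uE q = (q - q⁻¹)⁻¹ • (uK q - uKinv q) := by
  have h := RingQuot.mkAlgHom_rel ℂ (Rel.E_F (q := q))
  simpa only [uK, uF, uE, uKinv, gen, map_mul, map_smul, map_sub] using h

/-- The values of an algebra homomorphism on the four generators. -/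
def genVal {A : Type} (e f k k' : A) : Gen → A
  | Gen.E => e
  | Gen.F => f
  | Gen.K => k
  | Gen.Kinv => k'

/-- Four elements of an algebra satisfying the defining relations of the quantum group. -/
structure Relations (q : ℂ) {A : Type} [Ring A] [Algebra ℂ A] (e f k k' : A) : Prop where
  K_Kinv : k * k' = 1
  Kinv_K : k' * k = 1
  K_E : k * e = (q ^ 2) • (e * k)
  K_F : k * f = (q ^ 2)⁻¹ • (f * k)
  E_F : e * f - f * e = (q - q⁻¹)⁻¹ • (k - k')

section lift
variable {q : ℂ} {A : Type} [Ring A] [Algebra ℂ A] {e f k k' : A}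

/-- The algebra homomorphism out of `U_q(sl_2)` given by elements satisfying the relations. -/
def Uq.lift (h : Relations q e f k k') : Uq q →ₐ[ℂ] A :=
  RingQuot.liftAlgHom ℂ ⟨FreeAlgebra.lift ℂ (genVal e f k k'), by
    obtain ⟨h1, h2, h3, h4, h5⟩ := h
    intro x y h
    cases h <;> simp only [map_mul, map_smul, map_sub, map_one, FreeAlgebra.lift_ι_apply, genVal] <;>
      assumption⟩

theorem lift_uE (h : Relations q e f k k') : Uq.lift h (uE q) = e := by
  simp [Uq.lift, uE, gen, genVal]
theorem lift_uF (h : Relations q e f k k') : Uq.lift h (uF q) = f := by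
  simp [Uq.lift, uF, gen, genVal]
theorem lift_uK (h : Relations q e f k k') : Uq.lift h (uK q) = k := by
  simp [Uq.lift, uK, gen, genVal]
theorem lift_uKinv (h : Relations q e f k k') : Uq.lift h (uKinv q) = k' := by
  simp [Uq.lift, uKinv, gen, genVal]

end lift

theorem uE_uKinv {q : ℂ} : uE q * uKinv q = (q ^ 2) • (uKinv q * uE q) := by
  have h : uKinv q * (uK q * uE q) * uKinv q = uKinv q * ((q ^ 2) • (uE q * uK q)) * uKinv q := by
    rw [uK_uE]
  rw [← mul_assoc, uKinv_uK, one_mul] at h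
  rw [h, mul_smul_comm, smul_mul_assoc, mul_assoc, mul_assoc, uK_uKinv, mul_one]

theorem Generic.sq_ne {q : ℂ} (hq : Generic q) : q ^ 2 ≠ 0 := pow_ne_zero _ hq.1

theorem Generic.sub_ne {q : ℂ} (hq : Generic q) : q - q⁻¹ ≠ 0 := by
  intro h
  have h2 : q ^ (2 : ℤ) = 1 := by
    have : q = q⁻¹ := sub_eq_zero.mp h
    rw [zpow_two]
    nth_rewrite 2 [this]
    exact mul_inv_cancel₀ hq.1
  exact hq.2 2 (by norm_num) h2

theorem coproduct_relations {q : ℂ} (hq : Generic q) :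
    Relations q (uE q ⊗ₜ[ℂ] uK q + 1 ⊗ₜ[ℂ] uE q) (uF q ⊗ₜ[ℂ] 1 + uKinv q ⊗ₜ[ℂ] uF q)
      (uK q ⊗ₜ[ℂ] uK q) (uKinv q ⊗ₜ[ℂ] uKinv q) where
  K_Kinv := by simp [uK_uKinv, Algebra.TensorProduct.one_def]
  Kinv_K := by simp [uKinv_uK, Algebra.TensorProduct.one_def]
  K_E := by simp [mul_add, add_mul, uK_uE, TensorProduct.smul_tmul']
  K_F := by
    have : uK q * uKinv q = uKinv q * uK q := by rw [uK_uKinv, uKinv_uK]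
    simp [mul_add, add_mul, uK_uF, TensorProduct.smul_tmul', this]
  E_F := by
    have h1 : uE q * uF q = uF q * uE q + (q - q⁻¹)⁻¹ • (uK q - uKinv q) := by
      rw [← uE_uF]; abel
    simp only [mul_add, add_mul, Algebra.TensorProduct.tmul_mul_tmul, one_mul, mul_one,
      uE_uKinv, uK_uF, h1, TensorProduct.add_tmul, TensorProduct.tmul_add,
      TensorProduct.smul_tmul', TensorProduct.tmul_smul, TensorProduct.sub_tmul,
      TensorProduct.tmul_sub, smul_sub, smul_smul, inv_mul_cancel₀ hq.sq_ne, one_smul]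
    abel

/-- The coproduct, with `Δ(E) = E ⊗ K + 1 ⊗ E`, `Δ(K) = K ⊗ K`, `Δ(F) = F ⊗ 1 + K⁻¹ ⊗ F`. -/
def coproduct {q : ℂ} (hq : Generic q) : Uq q →ₐ[ℂ] Uq q ⊗[ℂ] Uq q :=
  Uq.lift (coproduct_relations hq)

/-! ### Representations -/

/-- A finite-dimensional representation of `U_q(sl_2)`. -/
structure UqRep (q : ℂ) where
  V : Type
  [acg : AddCommGroup V]
  [mod : Module ℂ V]
  [fd : FiniteDimensional ℂ V]
  ρ : Uq q →ₐ[ℂ] Module.End ℂ V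

attribute [instance] UqRep.acg UqRep.mod UqRep.fd

/-- The tensor product of two representations, with the action given by the coproduct. -/
abbrev UqRep.tensor {q : ℂ} (hq : Generic q) (M N : UqRep q) : UqRep q where
  V := M.V ⊗[ℂ] N.V
  ρ := (Module.endTensorEndAlgHom).comp
    ((Algebra.TensorProduct.map M.ρ N.ρ).comp (coproduct hq))

theorem trivial_relations (q : ℂ) : Relations q (0 : Module.End ℂ ℂ) 0 1 1 := by
  constructor <;> simp

/-- The trivial representation on `ℂ`. -/
abbrev UqRep.trivial (q : ℂ) : UqRep q where
  V := ℂ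
  ρ := Uq.lift (trivial_relations q)

/-- The vector `e_l` of the standard basis `e_0, …, e_s` of `ℂ^(s+1)`; it is `0` for `l > s`. -/
def e (s l : ℕ) : Fin (s + 1) → ℂ := fun j => if (j : ℕ) = l then 1 else 0

/-- The linear endomorphism of `ℂ^(s+1)` with prescribed values on `e_0, …, e_s`. -/
def opOfValues (s : ℕ) (f : ℕ → (Fin (s + 1) → ℂ)) : Module.End ℂ (Fin (s + 1) → ℂ) :=
  (Pi.basisFun ℂ (Fin (s + 1))).constr ℂ (fun l => f l)

def opE (q : ℂ) (s : ℕ) : Module.End ℂ (Fin (s + 1) → ℂ) :=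
  opOfValues s fun l => if l = 0 then 0 else (qnum q l * qnum q ((s : ℤ) - l + 1)) • e s (l - 1)
def opF (s : ℕ) : Module.End ℂ (Fin (s + 1) → ℂ) :=
  opOfValues s fun l => if l = s then 0 else e s (l + 1)
def opK (q : ℂ) (s : ℕ) : Module.End ℂ (Fin (s + 1) → ℂ) :=
  opOfValues s fun l => q ^ ((s : ℤ) - 2 * l) • e s l
def opKinv (q : ℂ) (s : ℕ) : Module.End ℂ (Fin (s + 1) → ℂ) :=
  opOfValues s fun l => q ^ (-((s : ℤ) - 2 * l)) • e s l

theorem e_eq_basis (s : ℕ) (l : Fin (s + 1)) : e s l = Pi.basisFun ℂ (Fin (s + 1)) l := by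
  ext j
  simp [e, Pi.single_apply, Fin.ext_iff]

theorem opOfValues_e (s : ℕ) (f : ℕ → (Fin (s + 1) → ℂ)) {l : ℕ} (hl : l ≤ s) :
    opOfValues s f (e s l) = f l := by
  have := e_eq_basis s ⟨l, Nat.lt_succ_of_le hl⟩
  simp only at this
  rw [this, opOfValues, Module.Basis.constr_basis]

theorem end_ext {s : ℕ} {V : Type} [AddCommGroup V] [Module ℂ V]
    {A B : (Fin (s + 1) → ℂ) →ₗ[ℂ] V}
    (h : ∀ l, l ≤ s → A (e s l) = B (e s l)) : A = B := by
  apply (Pi.basisFun ℂ (Fin (s + 1))).ext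
  intro l
  rw [← e_eq_basis]
  exact h l (Nat.le_of_lt_succ l.2)

theorem opE_zero (q : ℂ) (s : ℕ) : opE q s (e s 0) = 0 := by
  rw [opE, opOfValues_e _ _ (Nat.zero_le _)]; simp
theorem opE_succ (q : ℂ) {s l : ℕ} (hl : l + 1 ≤ s) :
    opE q s (e s (l + 1)) = (qnum q (l + 1) * qnum q ((s : ℤ) - l)) • e s l := by
  rw [opE, opOfValues_e _ _ hl]
  have : (s : ℤ) - (l + 1) + 1 = s - l := by ring
  simp [this]
theorem opF_e {s l : ℕ} (hl : l < s) : opF s (e s l) = e s (l + 1) := by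
  rw [opF, opOfValues_e _ _ hl.le]; simp [hl.ne]
theorem opF_last (s : ℕ) : opF s (e s s) = 0 := by
  rw [opF, opOfValues_e _ _ le_rfl]; simp
theorem opK_e (q : ℂ) {s l : ℕ} (hl : l ≤ s) :
    opK q s (e s l) = q ^ ((s : ℤ) - 2 * l) • e s l := by
  rw [opK, opOfValues_e _ _ hl]
theorem opKinv_e (q : ℂ) {s l : ℕ} (hl : l ≤ s) :
    opKinv q s (e s l) = q ^ (-((s : ℤ) - 2 * l)) • e s l := by
  rw [opKinv, opOfValues_e _ _ hl]

theorem qnum_comm {q : ℂ} (hq : Generic q) (a b : ℤ) :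
    qnum q (a + 1) * qnum q b - qnum q a * qnum q (b + 1) = qnum q (b - a) := by
  have h0 := hq.1
  have h1 : q * q - 1 ≠ 0 := by
    intro h
    apply hq.sub_ne
    field_simp
    linear_combination h
  have hd := hq.sub_ne
  have ha : q ^ a ≠ 0 := zpow_ne_zero _ h0
  have hb : q ^ b ≠ 0 := zpow_ne_zero _ h0
  simp only [qnum, zpow_add₀ h0, zpow_sub₀ h0, neg_add, zpow_neg, zpow_one, neg_sub]
  generalize q ^ a = x at *
  generalize q ^ b = y at *
  rw [div_mul_div_comm, div_mul_div_comm, ← sub_div, div_eq_div_iff (mul_ne_zero hd hd) hd]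
  field_simp
  ring

theorem qnum_ne {q : ℂ} (hq : Generic q) {m : ℤ} (hm : m ≠ 0) : qnum q m ≠ 0 := by
  rw [qnum]
  refine div_ne_zero ?_ hq.sub_ne
  intro h
  apply hq.2 (m + m) (by omega)
  rw [zpow_add₀ hq.1]
  nth_rewrite 2 [sub_eq_zero.mp h]
  rw [← zpow_add₀ hq.1]; simp

theorem qnum_zero (q : ℂ) : qnum q 0 = 0 := by simp [qnum]

theorem irrep_relations {q : ℂ} (hq : Generic q) (s : ℕ) :
    Relations q (opE q s) (opF s) (opK q s) (opKinv q s) where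
  K_Kinv := by
    refine end_ext fun l hl => ?_
    simp only [Module.End.mul_apply, Module.End.one_apply, opK_e q hl, opKinv_e q hl, map_smul,
      smul_smul, ← zpow_add₀ hq.1, neg_add_cancel, zpow_zero, one_smul]
  Kinv_K := by
    refine end_ext fun l hl => ?_
    simp only [Module.End.mul_apply, Module.End.one_apply, opK_e q hl, opKinv_e q hl, map_smul,
      smul_smul, ← zpow_add₀ hq.1, add_neg_cancel, zpow_zero, one_smul]
  K_E := by
    refine end_ext fun l hl => ?_
    rcases l with _ | l
    · simp [opK_e q hl, opE_zero]
    · have : l ≤ s := by omega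
      simp only [Module.End.mul_apply, LinearMap.smul_apply, opE_succ q hl, map_smul,
        opK_e q hl, opK_e q this, smul_smul]
      congr 1
      have : (s : ℤ) - 2 * l = 2 + (s - 2 * ((l + 1 : ℕ) : ℤ)) := by push_cast; ring
      rw [this, zpow_add₀ hq.1]
      norm_cast
      ring
  K_F := by
    refine end_ext fun l hl => ?_
    rcases hl.eq_or_lt with rfl | hl'
    · simp [opK_e q hl, opF_last]
    · have h2 : l + 1 ≤ s := hl'
      simp only [Module.End.mul_apply, LinearMap.smul_apply, opF_e hl', map_smul,
        opK_e q hl, opK_e q h2, smul_smul]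
      congr 1
      have : (s : ℤ) - 2 * ((l + 1 : ℕ) : ℤ) = -2 + (s - 2 * l) := by push_cast; ring
      rw [this, zpow_add₀ hq.1, zpow_neg]
      norm_cast
  E_F := by
    refine end_ext fun l hl => ?_
    have key : (q - q⁻¹)⁻¹ * (q ^ ((s : ℤ) - 2 * l) - q ^ (-((s : ℤ) - 2 * l)))
        = qnum q ((s : ℤ) - 2 * l) := by rw [qnum, div_eq_inv_mul]
    have key2 : qnum q (l + 1) * qnum q ((s : ℤ) - l) - qnum q l * qnum q ((s : ℤ) - l + 1)
        = qnum q ((s : ℤ) - 2 * l) := by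
      rw [qnum_comm hq]; congr 1; ring
    simp only [LinearMap.sub_apply, Module.End.mul_apply, LinearMap.smul_apply,
      opK_e q hl, opKinv_e q hl, ← sub_smul, smul_smul, key, ← key2]
    have hEF : opE q s (opF s (e s l)) = (qnum q (l + 1) * qnum q ((s : ℤ) - l)) • e s l := by
      rcases hl.eq_or_lt with rfl | hl'
      · simp [opF_last, qnum_zero]
      · rw [opF_e hl', opE_succ q hl']
    have hFE : opF s (opE q s (e s l)) = (qnum q l * qnum q ((s : ℤ) - l + 1)) • e s l := by
      rcases l with _ | l
      · simp [opE_zero, qnum_zero]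
      · rw [opE_succ q hl, map_smul, opF_e hl]
        push_cast
        congr 3
        ring
    rw [hEF, hFE, sub_smul]

/-- The `(s+1)`-dimensional irreducible representation with basis `e_0, …, e_s` and action
`K e_l = q^(s-2l) e_l`, `F e_l = e_(l+1)` (`0` for `l = s`),
`E e_l = [l] [s-l+1] e_(l-1)` (`0` for `l = 0`). -/
abbrev irrep {q : ℂ} (hq : Generic q) (s : ℕ) : UqRep q where
  V := Fin (s + 1) → ℂ
  ρ := Uq.lift (irrep_relations hq s)

/-- For a list `(s_p, …, s_1)`, the representation `M_(d_p) ⊗ ⋯ ⊗ M_(d_1)` with `d_i = s_i + 1`;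
the empty tensor product is the trivial representation. -/
def tp {q : ℂ} (hq : Generic q) : List ℕ → UqRep q
  | [] => UqRep.trivial q
  | s :: L => (irrep hq s).tensor hq (tp hq L)

/-- The highest weight vectors of weight `q^s`: those `v` with `E v = 0` and `K v = q^s v`. -/
def UqRep.HW {q : ℂ} (M : UqRep q) (s : ℕ) : Submodule ℂ M.V where
  carrier := {v | M.ρ (uE q) v = 0 ∧ M.ρ (uK q) v = q ^ s • v}
  zero_mem' := by simp
  add_mem' := by
    rintro a b ⟨h1, h2⟩ ⟨h3, h4⟩
    simp [h1, h2, h3, h4]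
  smul_mem' := by
    rintro c a ⟨h1, h2⟩
    simp [h1, h2, smul_comm c]

/-! ### The action of the generators -/

section actions
variable {q : ℂ} (M N : UqRep q)

/-- The actions of the generators on a representation. -/
def UqRep.E : Module.End ℂ M.V := M.ρ (uE q)
def UqRep.F : Module.End ℂ M.V := M.ρ (uF q)
def UqRep.K : Module.End ℂ M.V := M.ρ (uK q)
def UqRep.Kinv : Module.End ℂ M.V := M.ρ (uKinv q)

theorem UqRep.mem_HW {s : ℕ} {v : M.V} : v ∈ M.HW s ↔ M.E v = 0 ∧ M.K v = q ^ s • v := Iff.rfl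

theorem UqRep.K_Kinv (v : M.V) : M.K (M.Kinv v) = v := by
  have := congrArg (fun x => M.ρ x v) (uK_uKinv q)
  simp only [map_mul, map_one, map_smul] at this
  exact this
theorem UqRep.Kinv_K (v : M.V) : M.Kinv (M.K v) = v := by
  have := congrArg (fun x => M.ρ x v) (uKinv_uK q)
  simp only [map_mul, map_one, map_smul] at this
  exact this
theorem UqRep.K_E (v : M.V) : M.K (M.E v) = (q ^ 2) • M.E (M.K v) := by
  have := congrArg (fun x => M.ρ x v) (uK_uE q)
  simp only [map_mul, map_one, map_smul] at this
  exact this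
theorem UqRep.K_F (v : M.V) : M.K (M.F v) = (q ^ 2)⁻¹ • M.F (M.K v) := by
  have := congrArg (fun x => M.ρ x v) (uK_uF q)
  simp only [map_mul, map_one, map_smul] at this
  exact this
theorem UqRep.E_F (v : M.V) :
    M.E (M.F v) = M.F (M.E v) + (q - q⁻¹)⁻¹ • (M.K v - M.Kinv v) := by
  have := congrArg (fun x => M.ρ x v) (uE_uF q)
  simp at this
  rw [← sub_eq_iff_eq_add']
  exact this

theorem UqRep.K_weight {hq : Generic q} {v : M.V} {n : ℤ} (h : M.K v = q ^ n • v) (k : ℕ) :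
    M.K ((M.F ^ k) v) = q ^ (n - 2 * k) • (M.F ^ k) v := by
  induction k with
  | zero => simpa using h
  | succ k ih =>
    rw [pow_succ', Module.End.mul_apply, M.K_F, ih, map_smul, smul_smul]
    congr 1
    have : n - 2 * ((k + 1 : ℕ) : ℤ) = -2 + (n - 2 * k) := by push_cast; ring
    rw [this, zpow_add₀ hq.1, zpow_neg]
    norm_cast

theorem UqRep.Kinv_weight {hq : Generic q} {v : M.V} {n : ℤ} (h : M.K v = q ^ n • v) :
    M.Kinv v = q ^ (-n) • v := by
  have h2 := M.Kinv_K v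
  rw [h, map_smul] at h2
  nth_rewrite 2 [← h2]
  rw [smul_smul, ← zpow_add₀ hq.1]; simp

theorem UqRep.E_F_pow {hq : Generic q} {v : M.V} {n : ℤ} (h0 : M.E v = 0)
    (h : M.K v = q ^ n • v) (k : ℕ) :
    M.E ((M.F ^ (k + 1)) v) = (qnum q (k + 1) * qnum q (n - k)) • (M.F ^ k) v := by
  have hK := M.K_weight (hq := hq) h
  have step : ∀ k : ℕ, M.E ((M.F ^ (k + 1)) v)
      = M.F (M.E ((M.F ^ k) v)) + qnum q (n - 2 * k) • (M.F ^ k) v := by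
    intro k
    rw [pow_succ', Module.End.mul_apply, M.E_F, hK, M.Kinv_weight (hq := hq) (hK k), ← sub_smul,
      smul_smul, qnum, div_eq_inv_mul]
  induction k with
  | zero =>
    rw [step 0]
    have : qnum q 1 = 1 := by simp [qnum, div_self hq.sub_ne]
    simp [h0, this]
  | succ k ih =>
    rw [step, ih, map_smul, pow_succ' M.F k, Module.End.mul_apply, ← add_smul]
    congr 1
    have := qnum_comm hq (k + 1) (n - (k + 1))
    have e2 : n - ((k : ℤ) + 1) + 1 = n - k := by ring
    have e3 : n - ((k : ℤ) + 1) - (k + 1) = n - 2 * (k + 1) := by ring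
    rw [e2, e3] at this
    push_cast
    rw [← this]; ring

/-- A highest weight vector of negative weight in a finite-dimensional representation is zero. -/
theorem UqRep.eq_zero_of_neg {hq : Generic q} {v : M.V} {n : ℤ} (hn : n < 0) (h0 : M.E v = 0)
    (h : M.K v = q ^ n • v) : v = 0 := by
  by_contra hv
  have hne : ∀ k : ℕ, (M.F ^ k) v ≠ 0 := by
    intro k
    induction k with
    | zero => simpa using hv
    | succ k ih =>
      intro hk
      have := M.E_F_pow (hq := hq) h0 h k
      rw [hk, map_zero] at this
      exact smul_ne_zero (mul_ne_zero (qnum_ne hq (by omega)) (qnum_ne hq (by omega))) ih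
        this.symm
  have hinj : Function.Injective (fun k : ℕ => q ^ (n - 2 * (k : ℤ))) := by
    intro a b hab
    by_contra hne
    refine hq.2 ((n - 2 * (a : ℤ)) - (n - 2 * (b : ℤ))) (by omega) ?_
    rw [zpow_sub₀ hq.1]
    exact (div_eq_one_iff_eq (zpow_ne_zero _ hq.1)).mpr hab
  have hli := Module.End.eigenvectors_linearIndependent' M.K
    (fun k : ℕ => q ^ (n - 2 * (k : ℤ))) hinj (fun k => (M.F ^ k) v)
    (fun k => ⟨Module.End.mem_eigenspace_iff.mpr (M.K_weight (hq := hq) h k), hne k⟩)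
  exact not_finite_iff_infinite.mpr inferInstance hli.finite

/-- An invariant vector is annihilated by `F`. -/
theorem UqRep.F_eq_zero {hq : Generic q} {v : M.V} (h : v ∈ M.HW 0) : M.F v = 0 := by
  obtain ⟨h0, h1⟩ := M.mem_HW.mp h
  have h1' : M.K v = q ^ (0 : ℤ) • v := by simpa using h1
  refine M.eq_zero_of_neg (hq := hq) (n := -2) (by norm_num) ?_ ?_
  · have := M.E_F_pow (hq := hq) h0 h1' 0
    simpa [qnum_zero] using this
  · have := M.K_weight (hq := hq) h1' 1
    simpa using this

variable (hq : Generic q)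

theorem tensor_E (x : M.V) (y : N.V) :
    (M.tensor hq N).E (x ⊗ₜ[ℂ] y) = (M.E x ⊗ₜ[ℂ] N.K y + x ⊗ₜ[ℂ] N.E y : M.V ⊗[ℂ] N.V) := by
  have h : coproduct hq (uE q) = _ := lift_uE (coproduct_relations hq)
  change Module.endTensorEndAlgHom (Algebra.TensorProduct.map M.ρ N.ρ (coproduct hq (uE q)))
    (x ⊗ₜ[ℂ] y) = _
  rw [h]
  simp only [map_add, Algebra.TensorProduct.map_tmul, map_one, LinearMap.add_apply]
  rfl
theorem tensor_F (x : M.V) (y : N.V) :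
    (M.tensor hq N).F (x ⊗ₜ[ℂ] y) = (M.F x ⊗ₜ[ℂ] y + M.Kinv x ⊗ₜ[ℂ] N.F y : M.V ⊗[ℂ] N.V) := by
  have h : coproduct hq (uF q) = _ := lift_uF (coproduct_relations hq)
  change Module.endTensorEndAlgHom (Algebra.TensorProduct.map M.ρ N.ρ (coproduct hq (uF q)))
    (x ⊗ₜ[ℂ] y) = _
  rw [h]
  simp only [map_add, Algebra.TensorProduct.map_tmul, map_one, LinearMap.add_apply]
  rfl
theorem tensor_K (x : M.V) (y : N.V) :
    (M.tensor hq N).K (x ⊗ₜ[ℂ] y) = (M.K x ⊗ₜ[ℂ] N.K y : M.V ⊗[ℂ] N.V) := by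
  have h : coproduct hq (uK q) = _ := lift_uK (coproduct_relations hq)
  change Module.endTensorEndAlgHom (Algebra.TensorProduct.map M.ρ N.ρ (coproduct hq (uK q)))
    (x ⊗ₜ[ℂ] y) = _
  rw [h]
  simp only [map_add, Algebra.TensorProduct.map_tmul, map_one, LinearMap.add_apply]
  rfl

theorem irrep_E (s : ℕ) : (irrep hq s).E = opE q s := lift_uE (irrep_relations hq s)
theorem irrep_F (s : ℕ) : (irrep hq s).F = opF s := lift_uF (irrep_relations hq s)
theorem irrep_K (s : ℕ) : (irrep hq s).K = opK q s := lift_uK (irrep_relations hq s)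
theorem irrep_Kinv (s : ℕ) : (irrep hq s).Kinv = opKinv q s := lift_uKinv (irrep_relations hq s)
theorem trivial_E : (UqRep.trivial q).E = 0 := lift_uE (trivial_relations q)
theorem trivial_F : (UqRep.trivial q).F = 0 := lift_uF (trivial_relations q)
theorem trivial_K : (UqRep.trivial q).K = 1 := lift_uK (trivial_relations q)

end actions

/-! ### Placing a tensor component at infinity -/

section infinity
variable {q : ℂ} (hq : Generic q) (s : ℕ) (M : UqRep q)

/-- The coefficient `(-1)^(s-l) q^((l+1)(s-l))`. -/
def plusCoef (q : ℂ) (s l : ℕ) : ℂ := (-1) ^ (s - l) * q ^ (((l : ℤ) + 1) * ((s : ℤ) - l))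

/-- The coefficient `(-1)^(s-l) q^((l-1)(s-l))`. -/
def minusCoef (q : ℂ) (s l : ℕ) : ℂ := (-1) ^ (s - l) * q ^ (((l : ℤ) - 1) * ((s : ℤ) - l))

/-- `τ ↦ ∑_(l=0)^s (-1)^(s-l) q^((l+1)(s-l)) (e_l ⊗ F^(s-l) τ)`. -/
def plusExpansion : M.V →ₗ[ℂ] (Fin (s + 1) → ℂ) ⊗[ℂ] M.V :=
  ∑ l ∈ Finset.range (s + 1),
    plusCoef q s l • (TensorProduct.mk ℂ (Fin (s + 1) → ℂ) M.V (e s l) ∘ₗ M.F ^ (s - l))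

/-- `τ ↦ ∑_(l=0)^s (-1)^(s-l) q^((l-1)(s-l)) (F^(s-l) τ ⊗ e_l)`. -/
def minusExpansion : M.V →ₗ[ℂ] M.V ⊗[ℂ] (Fin (s + 1) → ℂ) :=
  ∑ l ∈ Finset.range (s + 1),
    minusCoef q s l • ((TensorProduct.mk ℂ M.V (Fin (s + 1) → ℂ)).flip (e s l) ∘ₗ M.F ^ (s - l))

theorem plusExpansion_apply (t : M.V) : plusExpansion s M t =
    ∑ l ∈ Finset.range (s + 1), plusCoef q s l • (e s l ⊗ₜ[ℂ] (M.F ^ (s - l)) t) := by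
  simp [plusExpansion]

theorem minusExpansion_apply (t : M.V) : minusExpansion s M t =
    ∑ l ∈ Finset.range (s + 1), minusCoef q s l • ((M.F ^ (s - l)) t ⊗ₜ[ℂ] e s l) := by
  simp [minusExpansion]

variable {s} in
theorem plusCoef_succ {q : ℂ} (hq : Generic q) {l : ℕ} (hl : l < s) :
    plusCoef q s l = -q ^ (2 * (l : ℤ) + 2 - s) * plusCoef q s (l + 1) := by
  have h1 : s - l = (s - (l + 1)) + 1 := by omega
  have h2 : ((l : ℤ) + 1) * ((s : ℤ) - l)
      = (2 * (l : ℤ) + 2 - s) + (((l + 1 : ℕ) : ℤ) + 1) * ((s : ℤ) - (l + 1 : ℕ)) := by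
    push_cast; ring
  rw [plusCoef, plusCoef, h1, h2, zpow_add₀ hq.1, pow_succ]; ring

variable {s} in
theorem minusCoef_succ {q : ℂ} (hq : Generic q) {l : ℕ} (hl : l < s) :
    minusCoef q s l = -q ^ (2 * (l : ℤ) - s) * minusCoef q s (l + 1) := by
  have h1 : s - l = (s - (l + 1)) + 1 := by omega
  have h2 : ((l : ℤ) - 1) * ((s : ℤ) - l)
      = (2 * (l : ℤ) - s) + (((l + 1 : ℕ) : ℤ) - 1) * ((s : ℤ) - (l + 1 : ℕ)) := by
    push_cast; ring
  rw [minusCoef, minusCoef, h1, h2, zpow_add₀ hq.1, pow_succ]; ring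

theorem plusCoef_last : plusCoef q s s = 1 := by simp [plusCoef]
theorem minusCoef_last : minusCoef q s s = 1 := by simp [minusCoef]

/-- The coefficient in `V` of `e_k` in a vector of `ℂ^(s+1) ⊗ V`. -/
def leftCoord (V : Type) [AddCommGroup V] [Module ℂ V] (k : ℕ) :
    (Fin (s + 1) → ℂ) ⊗[ℂ] V →ₗ[ℂ] V :=
  (TensorProduct.lid ℂ V).toLinearMap ∘ₗ
    LinearMap.rTensor V (∑ j : Fin (s + 1), if (j : ℕ) = k then LinearMap.proj j else 0)

/-- The coefficient in `V` of `e_k` in a vector of `V ⊗ ℂ^(s+1)`. -/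
def rightCoord (V : Type) [AddCommGroup V] [Module ℂ V] (k : ℕ) :
    V ⊗[ℂ] (Fin (s + 1) → ℂ) →ₗ[ℂ] V :=
  leftCoord s V k ∘ₗ (TensorProduct.comm ℂ V (Fin (s + 1) → ℂ)).toLinearMap

variable {s} in
theorem leftCoord_e {V : Type} [AddCommGroup V] [Module ℂ V] {l : ℕ} (hl : l ≤ s) (k : ℕ) (w : V) :
    leftCoord s V k (e s l ⊗ₜ[ℂ] w) = if l = k then w else 0 := by
  have : (∑ j : Fin (s + 1), if (j : ℕ) = k then (LinearMap.proj j : (Fin (s + 1) → ℂ) →ₗ[ℂ] ℂ)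
      else 0) (e s l) = if l = k then 1 else 0 := by
    rw [LinearMap.sum_apply, Finset.sum_eq_single ⟨l, Nat.lt_succ_of_le hl⟩]
    · by_cases h : l = k <;> simp [h, e]
    · intro j _ hj
      have : (j : ℕ) ≠ l := fun h => hj (Fin.ext h)
      by_cases h : (j : ℕ) = k <;> simp [h, e]
      · rw [← h]; exact this
    · simp
  simp only [leftCoord, LinearMap.comp_apply, LinearMap.rTensor_tmul, this]
  by_cases h : l = k <;> simp [h]

variable {s} in
theorem rightCoord_e {V : Type} [AddCommGroup V] [Module ℂ V] {l : ℕ} (hl : l ≤ s) (k : ℕ) (w : V) :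
    rightCoord s V k (w ⊗ₜ[ℂ] e s l) = if l = k then w else 0 := by
  simp [rightCoord, leftCoord_e hl]

theorem eq_sum_e (x : Fin (s + 1) → ℂ) :
    ∃ c : ℕ → ℂ, x = ∑ l ∈ Finset.range (s + 1), c l • e s l := by
  refine ⟨fun l => if h : l < s + 1 then x ⟨l, h⟩ else 0, ?_⟩
  ext j
  rw [Finset.sum_apply, Finset.sum_eq_single (j : ℕ)]
  · simp [e, j.2]
  · intro l _ hl
    simp [e, hl.symm]
  · intro h
    exact absurd (Finset.mem_range.mpr j.2) h

theorem exists_left {V : Type} [AddCommGroup V] [Module ℂ V] (v : (Fin (s + 1) → ℂ) ⊗[ℂ] V) :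
    ∃ w : ℕ → V, v = ∑ l ∈ Finset.range (s + 1), e s l ⊗ₜ[ℂ] w l := by
  induction v using TensorProduct.induction_on with
  | zero => exact ⟨0, by simp⟩
  | tmul x y =>
    obtain ⟨c, hc⟩ := eq_sum_e s x
    refine ⟨fun l => c l • y, ?_⟩
    rw [hc, TensorProduct.sum_tmul]
    simp [TensorProduct.smul_tmul]
  | add a b ha hb =>
    obtain ⟨w, hw⟩ := ha
    obtain ⟨w', hw'⟩ := hb
    refine ⟨w + w', ?_⟩
    simp [hw, hw', TensorProduct.tmul_add, Finset.sum_add_distrib]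

theorem exists_right {V : Type} [AddCommGroup V] [Module ℂ V] (v : V ⊗[ℂ] (Fin (s + 1) → ℂ)) :
    ∃ w : ℕ → V, v = ∑ l ∈ Finset.range (s + 1), w l ⊗ₜ[ℂ] e s l := by
  obtain ⟨w, hw⟩ := exists_left s (TensorProduct.comm ℂ _ _ v)
  refine ⟨w, (TensorProduct.comm ℂ V (Fin (s + 1) → ℂ)).injective ?_⟩
  simp [hw]

variable {s} in
theorem leftCoord_sum {V : Type} [AddCommGroup V] [Module ℂ V] (w : ℕ → V) {k : ℕ} (hk : k ≤ s) :
    leftCoord s V k (∑ l ∈ Finset.range (s + 1), e s l ⊗ₜ[ℂ] w l) = w k := by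
  rw [map_sum, Finset.sum_congr rfl fun l hl =>
    leftCoord_e (Nat.le_of_lt_succ (Finset.mem_range.mp hl)) k (w l)]
  simp
  omega

variable {s} in
theorem rightCoord_sum {V : Type} [AddCommGroup V] [Module ℂ V] (w : ℕ → V) {k : ℕ} (hk : k ≤ s) :
    rightCoord s V k (∑ l ∈ Finset.range (s + 1), w l ⊗ₜ[ℂ] e s l) = w k := by
  rw [map_sum, Finset.sum_congr rfl fun l hl =>
    rightCoord_e (Nat.le_of_lt_succ (Finset.mem_range.mp hl)) k (w l)]
  simp
  omega

/-- Reading off coefficients of the action of the generators on `M_d ⊗ V`. -/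
theorem left_E (w : ℕ → M.V) :
    ((irrep hq s).tensor hq M).E (∑ l ∈ Finset.range (s + 1), e s l ⊗ₜ[ℂ] w l :
      (Fin (s + 1) → ℂ) ⊗[ℂ] M.V) =
    (∑ l ∈ Finset.range (s + 1), e s l ⊗ₜ[ℂ]
      ((if l < s then (qnum q (l + 1) * qnum q ((s : ℤ) - l)) • M.K (w (l + 1)) else 0)
        + M.E (w l)) : (Fin (s + 1) → ℂ) ⊗[ℂ] M.V) := by
  have h1 : ∀ l, ((irrep hq s).tensor hq M).E (e s l ⊗ₜ[ℂ] w l : (Fin (s + 1) → ℂ) ⊗[ℂ] M.V) =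
      (opE q s (e s l) ⊗ₜ[ℂ] M.K (w l) + e s l ⊗ₜ[ℂ] M.E (w l) :
        (Fin (s + 1) → ℂ) ⊗[ℂ] M.V) := by
    intro l
    rw [← irrep_E hq]
    exact tensor_E (irrep hq s) M hq (e s l) (w l)
  refine (map_sum _ _ _).trans ((Finset.sum_congr rfl fun l _ => h1 l).trans ?_)
  change (∑ l ∈ Finset.range (s + 1),
    (opE q s (e s l) ⊗ₜ[ℂ] M.K (w l) + e s l ⊗ₜ[ℂ] M.E (w l)) :
      (Fin (s + 1) → ℂ) ⊗[ℂ] M.V) = _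
  simp only [TensorProduct.tmul_add, Finset.sum_add_distrib]
  congr 1
  rw [Finset.sum_range_succ', Finset.sum_range_succ]
  simp only [opE_zero, TensorProduct.zero_tmul, add_zero, lt_irrefl, if_false,
    TensorProduct.tmul_zero]
  refine Finset.sum_congr rfl fun l hl => ?_
  rw [Finset.mem_range] at hl
  rw [if_pos hl, opE_succ q hl, TensorProduct.smul_tmul]

theorem left_F (w : ℕ → M.V) :
    ((irrep hq s).tensor hq M).F (∑ l ∈ Finset.range (s + 1), e s l ⊗ₜ[ℂ] w l :
      (Fin (s + 1) → ℂ) ⊗[ℂ] M.V) =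
    (∑ l ∈ Finset.range (s + 1), e s l ⊗ₜ[ℂ]
      ((if l = 0 then 0 else w (l - 1)) + q ^ (-((s : ℤ) - 2 * l)) • M.F (w l)) :
        (Fin (s + 1) → ℂ) ⊗[ℂ] M.V) := by
  have h1 : ∀ l, ((irrep hq s).tensor hq M).F (e s l ⊗ₜ[ℂ] w l : (Fin (s + 1) → ℂ) ⊗[ℂ] M.V) =
      (opF s (e s l) ⊗ₜ[ℂ] w l + opKinv q s (e s l) ⊗ₜ[ℂ] M.F (w l) :
        (Fin (s + 1) → ℂ) ⊗[ℂ] M.V) := by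
    intro l
    rw [← irrep_F hq, ← irrep_Kinv hq]
    exact tensor_F (irrep hq s) M hq (e s l) (w l)
  refine (map_sum _ _ _).trans ((Finset.sum_congr rfl fun l _ => h1 l).trans ?_)
  change (∑ l ∈ Finset.range (s + 1),
    (opF s (e s l) ⊗ₜ[ℂ] w l + opKinv q s (e s l) ⊗ₜ[ℂ] M.F (w l)) :
      (Fin (s + 1) → ℂ) ⊗[ℂ] M.V) = _
  simp only [TensorProduct.tmul_add, Finset.sum_add_distrib]
  congr 1
  · rw [Finset.sum_range_succ, Finset.sum_range_succ']
    simp only [opF_last, TensorProduct.zero_tmul, add_zero, if_true, TensorProduct.tmul_zero]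
    refine Finset.sum_congr rfl fun l hl => ?_
    rw [Finset.mem_range] at hl
    simp [opF_e hl]
  · refine Finset.sum_congr rfl fun l hl => ?_
    rw [opKinv_e q (Nat.le_of_lt_succ (Finset.mem_range.mp hl)), TensorProduct.smul_tmul]

theorem left_K (w : ℕ → M.V) :
    ((irrep hq s).tensor hq M).K (∑ l ∈ Finset.range (s + 1), e s l ⊗ₜ[ℂ] w l :
      (Fin (s + 1) → ℂ) ⊗[ℂ] M.V) =
    (∑ l ∈ Finset.range (s + 1), e s l ⊗ₜ[ℂ] (q ^ ((s : ℤ) - 2 * l) • M.K (w l)) :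
        (Fin (s + 1) → ℂ) ⊗[ℂ] M.V) := by
  have h1 : ∀ l, ((irrep hq s).tensor hq M).K (e s l ⊗ₜ[ℂ] w l : (Fin (s + 1) → ℂ) ⊗[ℂ] M.V) =
      (opK q s (e s l) ⊗ₜ[ℂ] M.K (w l) : (Fin (s + 1) → ℂ) ⊗[ℂ] M.V) := by
    intro l
    rw [← irrep_K hq]
    exact tensor_K (irrep hq s) M hq (e s l) (w l)
  refine (map_sum _ _ _).trans ((Finset.sum_congr rfl fun l _ => h1 l).trans ?_)
  change (∑ l ∈ Finset.range (s + 1),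
    (opK q s (e s l) ⊗ₜ[ℂ] M.K (w l)) :
      (Fin (s + 1) → ℂ) ⊗[ℂ] M.V) = _
  refine Finset.sum_congr rfl fun l hl => ?_
  rw [opK_e q (Nat.le_of_lt_succ (Finset.mem_range.mp hl)), TensorProduct.smul_tmul]

/-- Reading off coefficients of the action of the generators on `V ⊗ M_d`. -/
theorem right_E (w : ℕ → M.V) :
    (M.tensor hq (irrep hq s)).E (∑ l ∈ Finset.range (s + 1), w l ⊗ₜ[ℂ] e s l :
      M.V ⊗[ℂ] (Fin (s + 1) → ℂ)) =
    (∑ l ∈ Finset.range (s + 1),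
      (q ^ ((s : ℤ) - 2 * l) • M.E (w l) +
       (if l < s then (qnum q (l + 1) * qnum q ((s : ℤ) - l)) • w (l + 1) else 0)) ⊗ₜ[ℂ] e s l :
        M.V ⊗[ℂ] (Fin (s + 1) → ℂ)) := by
  have h1 : ∀ l, (M.tensor hq (irrep hq s)).E (w l ⊗ₜ[ℂ] e s l : M.V ⊗[ℂ] (Fin (s + 1) → ℂ)) =
      (M.E (w l) ⊗ₜ[ℂ] opK q s (e s l) + w l ⊗ₜ[ℂ] opE q s (e s l) :
        M.V ⊗[ℂ] (Fin (s + 1) → ℂ)) := by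
    intro l
    rw [← irrep_E hq, ← irrep_K hq]
    exact tensor_E M (irrep hq s) hq (w l) (e s l)
  refine (map_sum _ _ _).trans ((Finset.sum_congr rfl fun l _ => h1 l).trans ?_)
  change (∑ l ∈ Finset.range (s + 1),
    (M.E (w l) ⊗ₜ[ℂ] opK q s (e s l) + w l ⊗ₜ[ℂ] opE q s (e s l)) :
      M.V ⊗[ℂ] (Fin (s + 1) → ℂ)) = _
  simp only [TensorProduct.add_tmul, Finset.sum_add_distrib]
  congr 1
  · refine Finset.sum_congr rfl fun l hl => ?_
    rw [opK_e q (Nat.le_of_lt_succ (Finset.mem_range.mp hl)), TensorProduct.smul_tmul]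
  · rw [Finset.sum_range_succ', Finset.sum_range_succ]
    simp only [opE_zero, TensorProduct.zero_tmul, add_zero, lt_irrefl, if_false,
      TensorProduct.tmul_zero]
    refine Finset.sum_congr rfl fun l hl => ?_
    rw [Finset.mem_range] at hl
    rw [if_pos hl, opE_succ q hl, TensorProduct.smul_tmul]

theorem right_F (w : ℕ → M.V) :
    (M.tensor hq (irrep hq s)).F (∑ l ∈ Finset.range (s + 1), w l ⊗ₜ[ℂ] e s l :
      M.V ⊗[ℂ] (Fin (s + 1) → ℂ)) =
    (∑ l ∈ Finset.range (s + 1),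
      (M.F (w l) + (if l = 0 then 0 else M.Kinv (w (l - 1)))) ⊗ₜ[ℂ] e s l :
        M.V ⊗[ℂ] (Fin (s + 1) → ℂ)) := by
  have h1 : ∀ l, (M.tensor hq (irrep hq s)).F (w l ⊗ₜ[ℂ] e s l : M.V ⊗[ℂ] (Fin (s + 1) → ℂ)) =
      (M.F (w l) ⊗ₜ[ℂ] e s l + M.Kinv (w l) ⊗ₜ[ℂ] opF s (e s l) :
        M.V ⊗[ℂ] (Fin (s + 1) → ℂ)) := by
    intro l
    rw [← irrep_F hq]
    exact tensor_F M (irrep hq s) hq (w l) (e s l)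
  refine (map_sum _ _ _).trans ((Finset.sum_congr rfl fun l _ => h1 l).trans ?_)
  change (∑ l ∈ Finset.range (s + 1),
    (M.F (w l) ⊗ₜ[ℂ] e s l + M.Kinv (w l) ⊗ₜ[ℂ] opF s (e s l)) :
      M.V ⊗[ℂ] (Fin (s + 1) → ℂ)) = _
  simp only [TensorProduct.add_tmul, Finset.sum_add_distrib]
  congr 1
  rw [Finset.sum_range_succ, Finset.sum_range_succ']
  simp only [opF_last, TensorProduct.zero_tmul, add_zero, if_true, TensorProduct.tmul_zero]
  refine Finset.sum_congr rfl fun l hl => ?_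
  rw [Finset.mem_range] at hl
  simp [opF_e hl]

theorem right_K (w : ℕ → M.V) :
    (M.tensor hq (irrep hq s)).K (∑ l ∈ Finset.range (s + 1), w l ⊗ₜ[ℂ] e s l :
      M.V ⊗[ℂ] (Fin (s + 1) → ℂ)) =
    (∑ l ∈ Finset.range (s + 1), (q ^ ((s : ℤ) - 2 * l) • M.K (w l)) ⊗ₜ[ℂ] e s l :
        M.V ⊗[ℂ] (Fin (s + 1) → ℂ)) := by
  have h1 : ∀ l, (M.tensor hq (irrep hq s)).K (w l ⊗ₜ[ℂ] e s l : M.V ⊗[ℂ] (Fin (s + 1) → ℂ)) =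
      (M.K (w l) ⊗ₜ[ℂ] opK q s (e s l) : M.V ⊗[ℂ] (Fin (s + 1) → ℂ)) := by
    intro l
    rw [← irrep_K hq]
    exact tensor_K M (irrep hq s) hq (w l) (e s l)
  refine (map_sum _ _ _).trans ((Finset.sum_congr rfl fun l _ => h1 l).trans ?_)
  change (∑ l ∈ Finset.range (s + 1),
    (M.K (w l) ⊗ₜ[ℂ] opK q s (e s l)) :
      M.V ⊗[ℂ] (Fin (s + 1) → ℂ)) = _
  refine Finset.sum_congr rfl fun l hl => ?_
  rw [opK_e q (Nat.le_of_lt_succ (Finset.mem_range.mp hl)), TensorProduct.smul_tmul]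

theorem plusExpansion_eq (t : M.V) : plusExpansion s M t =
    ∑ l ∈ Finset.range (s + 1), e s l ⊗ₜ[ℂ] (plusCoef q s l • (M.F ^ (s - l)) t) := by
  simp [plusExpansion_apply]

theorem minusExpansion_eq (t : M.V) : minusExpansion s M t =
    ∑ l ∈ Finset.range (s + 1), (minusCoef q s l • (M.F ^ (s - l)) t) ⊗ₜ[ℂ] e s l := by
  simp [minusExpansion_apply, TensorProduct.smul_tmul']

theorem zpow_weight {q : ℂ} {s : ℕ} {V : Type} [AddCommGroup V] [Module ℂ V]
    {K : Module.End ℂ V} {t : V} (h : K t = q ^ s • t) : K t = q ^ (s : ℤ) • t := by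
  rw [h, zpow_natCast]

theorem plusExpansion_mem (t : M.V) (ht : t ∈ M.HW s) :
    plusExpansion s M t ∈ ((irrep hq s).tensor hq M).HW 0 := by
  obtain ⟨h0, h1⟩ := M.mem_HW.mp ht
  replace h1 := zpow_weight h1
  have hK := M.K_weight (hq := hq) h1
  rw [UqRep.mem_HW, plusExpansion_eq]
  constructor
  · refine (left_E hq s M _).trans ?_
    refine Finset.sum_eq_zero fun l hl => ?_
    rcases (Nat.le_of_lt_succ (Finset.mem_range.mp hl)).eq_or_lt with rfl | hl'
    · simp [h0]
    · obtain ⟨k, rfl⟩ : ∃ k, s = l + 1 + k := ⟨s - (l + 1), by omega⟩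
      have e1 : l + 1 + k - l = k + 1 := by omega
      have e2 : l + 1 + k - (l + 1) = k := by omega
      rw [if_pos hl', map_smul, map_smul, e1, e2, hK, M.E_F_pow (hq := hq) h0 h1,
        plusCoef_succ hq hl', smul_smul, smul_smul, smul_smul, ← add_smul]
      refine (congrArg _ ?_).trans (TensorProduct.tmul_zero _ _)
      refine (congrArg (· • (M.F ^ k) t) ?_).trans (zero_smul ℂ _)
      have e3 : ((l + 1 + k : ℕ) : ℤ) - k = l + 1 := by push_cast; ring
      have e4 : ((l + 1 + k : ℕ) : ℤ) - l = k + 1 := by push_cast; ring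
      have e5 : ((l + 1 + k : ℕ) : ℤ) - 2 * k = 2 * (l : ℤ) + 2 - ((l + 1 + k : ℕ) : ℤ) := by
        push_cast; ring
      rw [e3, e4, e5]; ring
  · refine (left_K hq s M _).trans ?_
    rw [pow_zero, one_smul]
    refine Finset.sum_congr rfl fun l hl => ?_
    have hl' := Nat.le_of_lt_succ (Finset.mem_range.mp hl)
    have h2 : (s : ℤ) - 2 * ((s - l : ℕ) : ℤ) = -((s : ℤ) - 2 * l) := by omega
    rw [map_smul, hK, h2, smul_comm (plusCoef q s l), smul_smul, ← zpow_add₀ hq.1,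
      add_neg_cancel, zpow_zero, one_smul]

theorem minusExpansion_mem (t : M.V) (ht : t ∈ M.HW s) :
    minusExpansion s M t ∈ (M.tensor hq (irrep hq s)).HW 0 := by
  obtain ⟨h0, h1⟩ := M.mem_HW.mp ht
  replace h1 := zpow_weight h1
  have hK := M.K_weight (hq := hq) h1
  rw [UqRep.mem_HW, minusExpansion_eq]
  constructor
  · refine (right_E hq s M _).trans ?_
    refine Finset.sum_eq_zero fun l hl => ?_
    rcases (Nat.le_of_lt_succ (Finset.mem_range.mp hl)).eq_or_lt with rfl | hl'
    · simp [h0]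
    · obtain ⟨k, rfl⟩ : ∃ k, s = l + 1 + k := ⟨s - (l + 1), by omega⟩
      have e1 : l + 1 + k - l = k + 1 := by omega
      have e2 : l + 1 + k - (l + 1) = k := by omega
      rw [if_pos hl', map_smul, e1, e2, M.E_F_pow (hq := hq) h0 h1,
        minusCoef_succ hq hl', smul_smul, smul_smul, smul_smul, ← add_smul]
      refine (congrArg (· ⊗ₜ[ℂ] _) ?_).trans (TensorProduct.zero_tmul _ _)
      refine (congrArg (· • (M.F ^ k) t) ?_).trans (zero_smul ℂ _)
      have e3 : ((l + 1 + k : ℕ) : ℤ) - k = l + 1 := by push_cast; ring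
      have e4 : ((l + 1 + k : ℕ) : ℤ) - l = k + 1 := by push_cast; ring
      have e6 : q ^ (((l + 1 + k : ℕ) : ℤ) - 2 * l) * q ^ (2 * (l : ℤ) - ((l + 1 + k : ℕ) : ℤ))
          = 1 := by
        rw [← zpow_add₀ hq.1]; simp
      rw [e3, e4]
      linear_combination (-minusCoef q (l + 1 + k) (l + 1) * qnum q (k + 1) * qnum q (l + 1)) * e6
  · refine (right_K hq s M _).trans ?_
    rw [pow_zero, one_smul]
    refine Finset.sum_congr rfl fun l hl => ?_
    have hl' := Nat.le_of_lt_succ (Finset.mem_range.mp hl)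
    have h2 : (s : ℤ) - 2 * ((s - l : ℕ) : ℤ) = -((s : ℤ) - 2 * l) := by omega
    rw [map_smul, hK, h2, smul_comm (minusCoef q s l), smul_smul, ← zpow_add₀ hq.1,
      add_neg_cancel, zpow_zero, one_smul]

theorem plusExpansion_injective : Function.Injective (plusExpansion s M) := by
  intro a b hab
  have := congrArg (leftCoord s M.V s) hab
  rw [plusExpansion_eq, plusExpansion_eq, leftCoord_sum _ le_rfl, leftCoord_sum _ le_rfl] at this
  simpa [plusCoef_last] using this

theorem minusExpansion_injective : Function.Injective (minusExpansion s M) := by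
  intro a b hab
  have := congrArg (rightCoord s M.V s) hab
  rw [minusExpansion_eq, minusExpansion_eq, rightCoord_sum _ le_rfl, rightCoord_sum _ le_rfl]
    at this
  simpa [minusCoef_last] using this

theorem plusExpansion_surjective (v : (Fin (s + 1) → ℂ) ⊗[ℂ] M.V)
    (hv : v ∈ ((irrep hq s).tensor hq M).HW 0) : ∃ t ∈ M.HW s, plusExpansion s M t = v := by
  obtain ⟨w, rfl⟩ := exists_left s v
  obtain ⟨hE, hK⟩ := (UqRep.mem_HW _).mp hv
  have hF := UqRep.F_eq_zero (hq := hq) _ hv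
  have hE' := congrArg (leftCoord s M.V s) ((left_E hq s M w).symm.trans hE)
  have hK' := congrArg (leftCoord s M.V s) ((left_K hq s M w).symm.trans hK)
  rw [pow_zero, one_smul] at hK'
  rw [leftCoord_sum _ le_rfl] at hE' hK'
  rw [leftCoord_sum _ le_rfl] at hK'
  have hF' : ∀ l < s, w l = -q ^ (2 * (l : ℤ) + 2 - s) • M.F (w (l + 1)) := by
    intro l hl
    have h := congrArg (leftCoord s M.V (l + 1)) ((left_F hq s M w).symm.trans hF)
    rw [leftCoord_sum _ hl] at h
    have h' : w l + q ^ (-((s : ℤ) - 2 * (l + 1 : ℕ))) • M.F (w (l + 1)) = 0 := by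
      simpa using h.trans (map_zero _)
    have e1 : -((s : ℤ) - 2 * (l + 1 : ℕ)) = 2 * (l : ℤ) + 2 - s := by push_cast; ring
    rw [e1] at h'
    rw [neg_smul]
    exact eq_neg_of_add_eq_zero_left h'
  refine ⟨w s, M.mem_HW.mpr ⟨?_, ?_⟩, ?_⟩
  · have : M.E (w s) = leftCoord s M.V s 0 := by simpa using hE'
    rw [this, map_zero]
  · have e1 : (s : ℤ) - 2 * s = -s := by ring
    rw [e1] at hK'
    nth_rewrite 2 [← hK']
    rw [smul_smul, zpow_neg, zpow_natCast, mul_inv_cancel₀ (pow_ne_zero _ hq.1), one_smul]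
  · rw [plusExpansion_eq]
    have key : ∀ k l, l + k = s → plusCoef q s l • (M.F ^ k) (w s) = w l := by
      intro k
      induction k with
      | zero =>
        rintro l rfl
        simp [plusCoef_last]
      | succ k ih =>
        intro l hl
        rw [hF' l (by omega), ← ih (l + 1) (by omega), plusCoef_succ hq (by omega), map_smul,
          smul_smul, pow_succ', Module.End.mul_apply]
    refine Finset.sum_congr rfl fun l hl => ?_
    rw [key (s - l) l (by have := Finset.mem_range.mp hl; omega)]

theorem minusExpansion_surjective (v : M.V ⊗[ℂ] (Fin (s + 1) → ℂ))
    (hv : v ∈ (M.tensor hq (irrep hq s)).HW 0) : ∃ t ∈ M.HW s, minusExpansion s M t = v := by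
  obtain ⟨w, rfl⟩ := exists_right s v
  obtain ⟨hE, hK⟩ := (UqRep.mem_HW _).mp hv
  have hF := UqRep.F_eq_zero (hq := hq) _ hv
  have hE' := congrArg (rightCoord s M.V s) ((right_E hq s M w).symm.trans hE)
  have hK' : ∀ l ≤ s, q ^ ((s : ℤ) - 2 * l) • M.K (w l) = w l := by
    intro l hl
    have h := congrArg (rightCoord s M.V l) ((right_K hq s M w).symm.trans hK)
    rw [pow_zero, one_smul] at h
    rw [rightCoord_sum _ hl] at h
    rwa [rightCoord_sum _ hl] at h
  rw [rightCoord_sum _ le_rfl] at hE'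
  have hF' : ∀ l < s, w l = -q ^ (2 * (l : ℤ) - s) • M.F (w (l + 1)) := by
    intro l hl
    have h := congrArg (rightCoord s M.V (l + 1)) ((right_F hq s M w).symm.trans hF)
    rw [rightCoord_sum _ hl] at h
    have h' : M.F (w (l + 1)) + M.Kinv (w l) = 0 := by
      simpa using h.trans (map_zero _)
    have h2 : M.Kinv (w l) = q ^ ((s : ℤ) - 2 * l) • w l := by
      nth_rewrite 1 [← hK' l hl.le]
      rw [map_smul, M.Kinv_K]
    rw [h2] at h'
    have e6 : q ^ (2 * (l : ℤ) - s) * q ^ ((s : ℤ) - 2 * l) = 1 := by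
      rw [← zpow_add₀ hq.1]; simp
    rw [eq_neg_of_add_eq_zero_left h', smul_neg, neg_smul, neg_neg, smul_smul, e6, one_smul]
  refine ⟨w s, M.mem_HW.mpr ⟨?_, ?_⟩, ?_⟩
  · have : q ^ ((s : ℤ) - 2 * s) • M.E (w s) = 0 := by
      have h := hE'.trans (map_zero _)
      simpa using h
    exact (smul_eq_zero.mp this).resolve_left (zpow_ne_zero _ hq.1)
  · have hK' := hK' s le_rfl
    have e1 : (s : ℤ) - 2 * s = -s := by ring
    rw [e1] at hK'
    nth_rewrite 2 [← hK']
    rw [smul_smul, zpow_neg, zpow_natCast, mul_inv_cancel₀ (pow_ne_zero _ hq.1), one_smul]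
  · rw [minusExpansion_eq]
    have key : ∀ k l, l + k = s → minusCoef q s l • (M.F ^ k) (w s) = w l := by
      intro k
      induction k with
      | zero =>
        rintro l rfl
        simp [minusCoef_last]
      | succ k ih =>
        intro l hl
        rw [hF' l (by omega), ← ih (l + 1) (by omega), minusCoef_succ hq (by omega), map_smul,
          smul_smul, pow_succ', Module.End.mul_apply]
    refine Finset.sum_congr rfl fun l hl => ?_
    rw [key (s - l) l (by have := Finset.mem_range.mp hl; omega)]

/-- The isomorphism `τ ↦ ∑_l (-1)^(s-l) q^((l+1)(s-l)) (e_l ⊗ F^(s-l) τ)` from the highest weight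
vectors of weight `q^s` in `V` to the invariant vectors of `M_d ⊗ V`, where `d = s + 1`. -/
def plusEquiv : M.HW s ≃ₗ[ℂ] ((irrep hq s).tensor hq M).HW 0 :=
  LinearEquiv.ofBijective
    (LinearMap.restrict (M₂ := ((irrep hq s).tensor hq M).V) (plusExpansion s M)
      (plusExpansion_mem hq s M))
    ⟨fun a b h => Subtype.ext (plusExpansion_injective s M (congrArg Subtype.val h)),
      fun v => by
        obtain ⟨t, ht, h⟩ := plusExpansion_surjective hq s M v.1 v.2
        exact ⟨⟨t, ht⟩, Subtype.ext h⟩⟩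

/-- The isomorphism `τ ↦ ∑_l (-1)^(s-l) q^((l-1)(s-l)) (F^(s-l) τ ⊗ e_l)` from the highest weight
vectors of weight `q^s` in `V` to the invariant vectors of `V ⊗ M_d`, where `d = s + 1`. -/
def minusEquiv : M.HW s ≃ₗ[ℂ] (M.tensor hq (irrep hq s)).HW 0 :=
  LinearEquiv.ofBijective
    (LinearMap.restrict (M₂ := (M.tensor hq (irrep hq s)).V) (minusExpansion s M)
      (minusExpansion_mem hq s M))
    ⟨fun a b h => Subtype.ext (minusExpansion_injective s M (congrArg Subtype.val h)),
      fun v => by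
        obtain ⟨t, ht, h⟩ := minusExpansion_surjective hq s M v.1 v.2
        exact ⟨⟨t, ht⟩, Subtype.ext h⟩⟩

end infinity

/-! ### The cyclic permutation map -/

section cyclic
variable {q : ℂ} (hq : Generic q)

/-- The associativity identification of `M_(d_p) ⊗ ⋯ ⊗ M_(d_1) ⊗ M_d` with
`(M_(d_p) ⊗ ⋯ ⊗ M_(d_1)) ⊗ M_d`, where the list is `(s_p, …, s_1)`. -/
def appendEquiv (s : ℕ) : (L : List ℕ) →
    (tp hq (L ++ [s])).V ≃ₗ[ℂ] (tp hq L).V ⊗[ℂ] (Fin (s + 1) → ℂ)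
  | [] => TensorProduct.comm ℂ (Fin (s + 1) → ℂ) ℂ
  | t :: L =>
    (TensorProduct.congr (LinearEquiv.refl ℂ (Fin (t + 1) → ℂ)) (appendEquiv s L)).trans
      (TensorProduct.assoc ℂ (Fin (t + 1) → ℂ) (tp hq L).V (Fin (s + 1) → ℂ)).symm

theorem tensor_E_eq (M N : UqRep q) : (M.tensor hq N).E =
    (TensorProduct.map M.E N.K + TensorProduct.map 1 N.E : Module.End ℂ (M.V ⊗[ℂ] N.V)) :=
  TensorProduct.ext' fun x y => tensor_E M N hq x y

theorem tensor_K_eq (M N : UqRep q) : (M.tensor hq N).K =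
    (TensorProduct.map M.K N.K : Module.End ℂ (M.V ⊗[ℂ] N.V)) :=
  TensorProduct.ext' fun x y => tensor_K M N hq x y

theorem assoc_comm (A B N P : UqRep q) (φ : P.V ≃ₗ[ℂ] B.V ⊗[ℂ] N.V)
    (hE : ∀ v, φ (P.E v) = (B.tensor hq N).E (φ v))
    (hK : ∀ v, φ (P.K v) = (B.tensor hq N).K (φ v))
    (Φ : A.V ⊗[ℂ] P.V ≃ₗ[ℂ] (A.V ⊗[ℂ] B.V) ⊗[ℂ] N.V)
    (hΦ : Φ = (TensorProduct.congr (LinearEquiv.refl ℂ A.V) φ).trans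
      (TensorProduct.assoc ℂ A.V B.V N.V).symm) :
    (∀ v, Φ ((A.tensor hq P).E v) = ((A.tensor hq B).tensor hq N).E (Φ v)) ∧
    (∀ v, Φ ((A.tensor hq P).K v) = ((A.tensor hq B).tensor hq N).K (Φ v)) := by
  subst hΦ
  simp only [tensor_E_eq, tensor_K_eq] at hE hK ⊢
  constructor <;> intro v
  · induction v using TensorProduct.induction_on with
    | zero => simp only [map_zero]
    | add a b ha hb => simp only [map_add, ha, hb]
    | tmul x y =>
      simp only [LinearMap.add_apply, TensorProduct.map_tmul, map_add, TensorProduct.congr_tmul,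
        LinearEquiv.refl_apply, LinearEquiv.trans_apply, hE, hK, Module.End.one_apply]
      generalize φ y = z
      induction z using TensorProduct.induction_on with
      | zero => simp only [map_zero, TensorProduct.tmul_zero, add_zero]
      | tmul a b =>
        simp [TensorProduct.add_tmul, TensorProduct.tmul_add, add_assoc]
      | add a b ha hb =>
        have h := congrArg₂ (· + ·) ha hb
        simp only [map_add, TensorProduct.tmul_add] at h ⊢
        refine Eq.trans ?_ (h.trans ?_) <;> abel
  · induction v using TensorProduct.induction_on with
    | zero => simp only [map_zero]
    | add a b ha hb => simp only [map_add, ha, hb]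
    | tmul x y =>
      simp only [TensorProduct.map_tmul, TensorProduct.congr_tmul, LinearEquiv.trans_apply,
        LinearEquiv.refl_apply, hK]
      generalize φ y = z
      induction z using TensorProduct.induction_on with
      | zero => simp only [map_zero, TensorProduct.tmul_zero]
      | tmul a b => simp
      | add a b ha hb => simp only [map_add, TensorProduct.tmul_add, ha, hb]

theorem comm_trivial (A : UqRep q) (Φ : A.V ⊗[ℂ] ℂ ≃ₗ[ℂ] ℂ ⊗[ℂ] A.V)
    (hΦ : Φ = TensorProduct.comm ℂ A.V ℂ) :
    (∀ v, Φ ((A.tensor hq (UqRep.trivial q)).E v) = ((UqRep.trivial q).tensor hq A).E (Φ v)) ∧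
    (∀ v, Φ ((A.tensor hq (UqRep.trivial q)).K v) = ((UqRep.trivial q).tensor hq A).K (Φ v)) := by
  subst hΦ
  simp only [tensor_E_eq, tensor_K_eq, trivial_E, trivial_K]
  constructor <;> intro v
  · induction v using TensorProduct.induction_on with
    | zero => simp
    | tmul x y => simp
    | add a b ha hb => simp only [map_add, ha, hb]
  · induction v using TensorProduct.induction_on with
    | zero => simp
    | tmul x y => simp
    | add a b ha hb => simp only [map_add, ha, hb]

/-- The identification intertwines the actions of `E` and `K`. -/
theorem appendEquiv_comm (s : ℕ) : (L : List ℕ) →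
    (∀ v, appendEquiv hq s L ((tp hq (L ++ [s])).E v) =
      ((tp hq L).tensor hq (irrep hq s)).E (appendEquiv hq s L v)) ∧
    (∀ v, appendEquiv hq s L ((tp hq (L ++ [s])).K v) =
      ((tp hq L).tensor hq (irrep hq s)).K (appendEquiv hq s L v))
  | [] => comm_trivial hq (irrep hq s) (appendEquiv hq s []) rfl
  | t :: L => assoc_comm hq (irrep hq t) (tp hq L) (irrep hq s) (tp hq (L ++ [s]))
      (appendEquiv hq s L) (appendEquiv_comm s L).1 (appendEquiv_comm s L).2
      (appendEquiv hq s (t :: L)) rfl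

theorem appendEquiv_map (s : ℕ) (L : List ℕ) :
    ((tp hq (L ++ [s])).HW 0).map (appendEquiv hq s L).toLinearMap =
      ((tp hq L).tensor hq (irrep hq s)).HW 0 := by
  obtain ⟨hE, hK⟩ := appendEquiv_comm hq s L
  ext v
  obtain ⟨u, rfl⟩ := (appendEquiv hq s L).surjective v
  rw [Submodule.mem_map_equiv, LinearEquiv.symm_apply_apply, UqRep.mem_HW, UqRep.mem_HW, ← hE,
    ← hK, pow_zero, one_smul, one_smul, (appendEquiv hq s L).injective.eq_iff,
    LinearEquiv.map_eq_zero_iff]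

/-- The invariant vectors `H_ς^(0)` of `M_(d_p) ⊗ ⋯ ⊗ M_(d_1)`, for the list `(s_p, …, s_1)`. -/
abbrev H (L : List ℕ) : Type := (tp hq L).HW 0

/-- The isomorphism `R_+` from `H_(ς,s)^(0)` to `H_ς^(s)`: it sends `v` to the unique `τ` with
`v = ∑_l (-1)^(s-l) q^((l+1)(s-l)) (e_l ⊗ F^(s-l) τ)`. -/
def Rplus (s : ℕ) (L : List ℕ) : H hq (s :: L) ≃ₗ[ℂ] (tp hq L).HW s :=
  (plusEquiv hq s (tp hq L)).symm

/-- The isomorphism `R_-` from `H_(s,ς)^(0)` to `H_ς^(s)`: it sends `v` to the unique `τ` with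
`v = ∑_l (-1)^(s-l) q^((l-1)(s-l)) (F^(s-l) τ ⊗ e_l)`. -/
def Rminus (s : ℕ) (L : List ℕ) : H hq (L ++ [s]) ≃ₗ[ℂ] (tp hq L).HW s :=
  (LinearEquiv.ofSubmodules (appendEquiv hq s L) _
    (((tp hq L).tensor hq (irrep hq s)).HW 0) (appendEquiv_map hq s L)).trans
    (minusEquiv hq s (tp hq L)).symm

/-- The cyclic permutation map `S^(s) = R_-⁻¹ ∘ R_+` from `H_(ς,s)^(0)` to `H_(s,ς)^(0)`. -/
def S (s : ℕ) (L : List ℕ) : H hq (s :: L) ≃ₗ[ℂ] H hq (L ++ [s]) :=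
  (Rplus hq s L).trans (Rminus hq s L).symm

/-- The identification of `H_ς^(0)` with `H_ς'^(0)` when `ς = ς'`. -/
def castH {L L' : List ℕ} (h : L = L') : H hq L ≃ₗ[ℂ] H hq L' :=
  h ▸ LinearEquiv.refl ℂ (H hq L)

/-- The successive application of the cyclic permutation maps for the entries of the list
`L = (s_k, …, s_1)`, starting with `S^(s_k)` and ending with `S^(s_1)`, on the invariant vectors
for the concatenation of `L` and a further list `D`. -/
def rotate : (L D : List ℕ) → H hq (L ++ D) →ₗ[ℂ] H hq (D ++ L)
  | [], D => (castH hq (by simp)).toLinearMap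
  | s :: L, D =>
    (castH hq (by simp)).toLinearMap ∘ₗ rotate L (D ++ [s]) ∘ₗ
      (castH hq (by simp)).toLinearMap ∘ₗ (S hq s (L ++ D)).toLinearMap

/-- The space `H_ς^(0)` of invariant vectors in `M_(d_p) ⊗ ⋯ ⊗ M_(d_1)`, for
`ς = (s_1, …, s_p)` and `d_i = s_i + 1`. -/
abbrev InvariantSpace {p : ℕ} (ς : Fin p → ℕ) : Type := H hq (List.ofFn ς).reverse

/-- The composed map `S^(s_1) ∘ S^(s_2) ∘ ⋯ ∘ S^(s_p)` on `H_ς^(0)`. -/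
def cyclicComposition {p : ℕ} (ς : Fin p → ℕ) : InvariantSpace hq ς →ₗ[ℂ] InvariantSpace hq ς :=
  rotate hq (List.ofFn ς).reverse [] ∘ₗ (castH hq (by simp)).toLinearMap

end cyclic

end

end QuantumSl2

namespace QuantumSl2

open TensorProduct

noncomputable section

/-! ### Weight vectors and the parity of the total weight -/

section basis
variable {q : ℂ}

/-! The expansions defining $R_+$ and $R_-$ involve the same vectors $F^{s-l}\tau$, and their
coefficients differ only by the power $q^{-2(s-l)}$. Hence $S^{(s)}$ is the restriction to invariant
vectors of a map that makes sense on the whole tensor product and no longer mentions $\tau$: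
$e_l\otimes x\mapsto q^{-2(s-l)}\,x\otimes e_l$, which is $q^{-s}K^{-1}$ on the leftmost factor
followed by moving that factor to the right end (`S_val`).

After all $p$ factors have been moved, each is back in its place, and $e_{l_p}\otimes\cdots\otimes
e_{l_1}$ has been multiplied by $q^{-2\sum(s_i-l_i)}$ (`rotateTensor_basisTensor`). Its $K$-weight
is $q^{\sum(s_i-2l_i)}$, so $K$ composed with the full rotation is the scalar $q^{-\sum s_i}$ on the
whole tensor product (`K_rotateTensor`). The rotation preserves invariant vectors, where $K$ acts as
$1$, so there it equals $q^{-\sum s_i}$.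

The sign $(-1)^{\sum s_i}$ costs nothing: every $K$-weight is $q^n$ with $n\equiv\sum s_i$ modulo
$2$, and $q$ is not a root of unity, so for odd $\sum s_i$ the only invariant vector is zero
(`eq_zero_of_odd_sum`). -/

theorem e_eq_zero {s l : ℕ} (h : s < l) : e s l = 0 := by
  ext j
  have : (j : ℕ) ≠ l := by omega
  simp [e, this]

/-- Both sides vanish for `l > s`. Dropping the bound lets index lists below be constrained by their
length alone. -/
theorem opK_e_all (q : ℂ) (s l : ℕ) : opK q s (e s l) = q ^ ((s : ℤ) - 2 * l) • e s l := by
  rcases le_or_gt l s with h | h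
  · exact opK_e q h
  · simp [e_eq_zero h]

theorem opKinv_e_all (q : ℂ) (s l : ℕ) :
    opKinv q s (e s l) = q ^ (-((s : ℤ) - 2 * l)) • e s l := by
  rcases le_or_gt l s with h | h
  · exact opKinv_e q h
  · simp [e_eq_zero h]

variable (hq : Generic q)

/-- The vector `e_(l_p) ⊗ ⋯ ⊗ e_(l_1)` of `M_(d_p) ⊗ ⋯ ⊗ M_(d_1)`; it is zero if there are too
few indices. -/
def basisTensor : (L : List ℕ) → List ℕ → (tp hq L).V
  | [], _ => (1 : ℂ)
  | _ :: _, [] => 0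
  | s :: L, l :: ls => (e s l ⊗ₜ[ℂ] basisTensor L ls : (Fin (s + 1) → ℂ) ⊗[ℂ] (tp hq L).V)

/-- Only spanning is needed, never linear independence, so the zero vectors coming from out-of-range
indices do no harm. -/
theorem span_basisTensor : (L : List ℕ) →
    Submodule.span ℂ {v | ∃ ls : List ℕ, ls.length = L.length ∧ v = basisTensor hq L ls} = ⊤
  | [] => by
    rw [Submodule.eq_top_iff']
    intro v
    change ℂ at v
    have h1 : (v • basisTensor hq [] [] : (tp hq []).V) ∈
        Submodule.span ℂ {v | ∃ ls : List ℕ, ls.length = ([] : List ℕ).length ∧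
          v = basisTensor hq [] ls} :=
      Submodule.smul_mem _ _ (Submodule.subset_span ⟨[], rfl, rfl⟩)
    have h2 : (v • basisTensor hq [] [] : (tp hq []).V) = v := mul_one v
    rwa [h2] at h1
  | s :: L => by
    have ih := span_basisTensor L
    rw [Submodule.eq_top_iff']
    intro v
    obtain ⟨w, rfl⟩ := exists_left s (V := (tp hq L).V) v
    refine Submodule.sum_mem _ fun l _ => ?_
    -- The map $y\mapsto e_l\otimes y$ is linear, so it is enough to treat $y$ in the spanning set
    -- of the remaining factors.
    have hw : w l ∈ Submodule.span ℂ
        {v | ∃ ls : List ℕ, ls.length = L.length ∧ v = basisTensor hq L ls} := by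
      rw [ih]; trivial
    generalize w l = y at hw
    induction hw using Submodule.span_induction with
    | mem x hx =>
      obtain ⟨ls, hls, rfl⟩ := hx
      exact Submodule.subset_span ⟨l :: ls, by simp [hls], rfl⟩
    | zero => rw [TensorProduct.tmul_zero]; exact Submodule.zero_mem _
    | add x y _ _ hx hy => rw [TensorProduct.tmul_add]; exact Submodule.add_mem _ hx hy
    | smul c x _ hx => rw [TensorProduct.tmul_smul]; exact Submodule.smul_mem _ c hx

theorem linearMap_ext_basisTensor {L : List ℕ} {W : Type} [AddCommGroup W] [Module ℂ W]
    {A B : (tp hq L).V →ₗ[ℂ] W}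
    (h : ∀ ls : List ℕ, ls.length = L.length →
      A (basisTensor hq L ls) = B (basisTensor hq L ls)) : A = B := by
  refine LinearMap.ext_on (span_basisTensor hq L) ?_
  rintro _ ⟨ls, hls, rfl⟩
  exact h ls hls

/-- Since $\Delta(K)=K\otimes K$, the exponents $s_i-2l_i$ of the factors add up. -/
theorem K_basisTensor : (L ls : List ℕ) → ls.length = L.length →
    (tp hq L).K (basisTensor hq L ls) =
      q ^ ((L.sum : ℤ) - 2 * (ls.sum : ℤ)) • basisTensor hq L ls
  | [], [], _ => by
    have h : (tp hq []).K = 1 := trivial_K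
    simp [h]
  | s :: L, l :: ls, h => by
    have ih := K_basisTensor L ls (by simpa using h)
    refine (tensor_K (irrep hq s) (tp hq L) hq (e s l) (basisTensor hq L ls)).trans ?_
    rw [irrep_K, opK_e_all, ih, TensorProduct.tmul_smul, TensorProduct.smul_tmul', smul_smul,
      ← zpow_add₀ hq.1]
    have h1 : ((L.sum : ℤ) - 2 * (ls.sum : ℤ) + ((s : ℤ) - 2 * l)) =
        (((s :: L).sum : ℕ) : ℤ) - 2 * (((l :: ls).sum : ℕ) : ℤ) := by
      push_cast [List.sum_cons]; ring
    rw [h1, ← TensorProduct.smul_tmul']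
    rfl

/-- Nonzero invariant vectors exist only if `s_1 + ⋯ + s_p` is even. -/
theorem eq_zero_of_odd_sum {L : List ℕ} (hL : ¬ Even L.sum) {v : (tp hq L).V}
    (hv : v ∈ (tp hq L).HW 0) : v = 0 := by
  have hK : (tp hq L).K v = (1 : ℂ) • v := by simpa using ((tp hq L).mem_HW.mp hv).2
  -- The eigenspace of $K$ for the eigenvalue $1$ is disjoint from the sum of all the others. That
  -- sum turns out to be the whole space, which forces the eigenspace to be zero.
  have hdis := Module.End.eigenspaces_iSupIndep (tp hq L).K 1
  have htop : (⨆ (μ : ℂ) (_ : μ ≠ 1), (tp hq L).K.eigenspace μ) = ⊤ := by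
    rw [eq_top_iff, ← span_basisTensor hq L, Submodule.span_le]
    rintro _ ⟨ls, hls, rfl⟩
    -- The exponent has the parity of `L.sum`, so it is odd, hence nonzero, and genericity of $q$
    -- keeps this eigenvalue away from $1$.
    refine Submodule.mem_iSup_of_mem (q ^ ((L.sum : ℤ) - 2 * (ls.sum : ℤ)))
      (Submodule.mem_iSup_of_mem (hq.2 _ fun h => hL ?_) ?_)
    · rw [Nat.even_iff]; omega
    · exact Module.End.mem_eigenspace_iff.mpr (K_basisTensor hq L ls hls)
  rw [htop, disjoint_top] at hdis
  have := Module.End.mem_eigenspace_iff.mpr hK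
  rwa [hdis, Submodule.mem_bot] at this

end basis

/-! ### The cyclic permutation map as a weighted shift of the whole tensor product -/

section rotation
variable {q : ℂ} (hq : Generic q)

/-- Reassociation merely splits off the last tensor factor, so on these vectors a shift becomes a
rotation of index lists. -/
theorem appendEquiv_basisTensor (s l : ℕ) : (L ls : List ℕ) → ls.length = L.length →
    appendEquiv hq s L (basisTensor hq (L ++ [s]) (ls ++ [l])) =
      basisTensor hq L ls ⊗ₜ[ℂ] e s l
  | [], [], _ => rfl
  | t :: L, k :: ls, h => by
    have ih := appendEquiv_basisTensor s l L ls (by simpa using h)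
    change (TensorProduct.assoc ℂ (Fin (t + 1) → ℂ) (tp hq L).V (Fin (s + 1) → ℂ)).symm
      (e t k ⊗ₜ[ℂ] appendEquiv hq s L (basisTensor hq (L ++ [s]) (ls ++ [l]))) = _
    rw [ih]
    rfl

/-- The map `e_l ⊗ x ↦ q^(-2(s-l)) (x ⊗ e_l)` on the whole tensor product. -/
def cyclicShift (s : ℕ) (L : List ℕ) : (tp hq (s :: L)).V →ₗ[ℂ] (tp hq (L ++ [s])).V :=
  (q ^ (-(s : ℤ))) • ((appendEquiv hq s L).symm.toLinearMap ∘ₗ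
    (TensorProduct.comm ℂ (Fin (s + 1) → ℂ) (tp hq L).V).toLinearMap ∘ₗ
      LinearMap.rTensor (tp hq L).V (opKinv q s))

theorem cyclicShift_tmul (s l : ℕ) (L : List ℕ) (x : (tp hq L).V) :
    cyclicShift hq s L (e s l ⊗ₜ[ℂ] x : (Fin (s + 1) → ℂ) ⊗[ℂ] (tp hq L).V) =
      q ^ (-2 * ((s : ℤ) - l)) • (appendEquiv hq s L).symm (x ⊗ₜ[ℂ] e s l) := by
  change q ^ (-(s : ℤ)) • (appendEquiv hq s L).symm
    ((TensorProduct.comm ℂ (Fin (s + 1) → ℂ) (tp hq L).V)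
      (LinearMap.rTensor (tp hq L).V (opKinv q s) (e s l ⊗ₜ[ℂ] x))) = _
  rw [LinearMap.rTensor_tmul, opKinv_e_all, ← TensorProduct.smul_tmul', map_smul, map_smul,
    smul_smul, ← zpow_add₀ hq.1, TensorProduct.comm_tmul]
  congr 2
  ring

/-- This removes the highest weight vector $\tau$ from the picture: the two expansions agree term by
term up to the flip and a factor depending only on $s$ and $l$. -/
theorem S_val (s : ℕ) (L : List ℕ) (v : H hq (s :: L)) :
    (S hq s L v).1 = cyclicShift hq s L v.1 := by
  -- With $v$ written as the expansion of $\tau$, the map $R_+$ cancels and $S^{(s)}v$ is the other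
  -- expansion of the same $\tau$.
  obtain ⟨t, rfl⟩ := (plusEquiv hq s (tp hq L)).surjective v
  have h1 : (S hq s L (plusEquiv hq s (tp hq L) t)).1 =
      (appendEquiv hq s L).symm (minusExpansion s (tp hq L) t.1) := by
    change ((Rminus hq s L).symm
      ((plusEquiv hq s (tp hq L)).symm (plusEquiv hq s (tp hq L) t))).1 = _
    rw [LinearEquiv.symm_apply_apply]
    rfl
  have h2 : (plusEquiv hq s (tp hq L) t).1 = plusExpansion s (tp hq L) t.1 := rfl
  rw [h1, h2, plusExpansion_apply, minusExpansion_apply]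
  refine (map_sum _ _ _).trans (Eq.trans ?_ (map_sum (cyclicShift hq s L) _ _).symm)
  refine Finset.sum_congr rfl fun l _ => ?_
  refine Eq.trans ?_ (map_smul (cyclicShift hq s L) _ _).symm
  rw [cyclicShift_tmul, map_smul, smul_smul, plusCoef, minusCoef, mul_assoc, ← zpow_add₀ hq.1]
  -- What is left is $(l-1)(s-l)=(l+1)(s-l)-2(s-l)$; the signs already agree.
  congr 3
  ring

theorem cyclicShift_basisTensor (s l : ℕ) {L ls : List ℕ} (h : ls.length = L.length) :
    cyclicShift hq s L (basisTensor hq (s :: L) (l :: ls)) =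
      q ^ (-2 * ((s : ℤ) - l)) • basisTensor hq (L ++ [s]) (ls ++ [l]) := by
  refine (cyclicShift_tmul hq s l L (basisTensor hq L ls)).trans ?_
  rw [← appendEquiv_basisTensor hq s l L ls h, LinearEquiv.symm_apply_apply]

/-! ### Composing the shifts -/

/-- The identification of the tensor products for equal lists. -/
def castTensor {L L' : List ℕ} (h : L = L') : (tp hq L).V →ₗ[ℂ] (tp hq L').V :=
  h ▸ LinearMap.id

/-- Because the index list does not depend on `L`, transport along an equality of lists is invisible
on these vectors. -/
theorem castTensor_basisTensor {L L' : List ℕ} (h : L = L') (ls : List ℕ) :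
    castTensor hq h (basisTensor hq L ls) = basisTensor hq L' ls := by
  subst h; rfl

theorem castH_val {L L' : List ℕ} (h : L = L') (v : H hq L) :
    (castH hq h v).1 = castTensor hq h v.1 := by
  subst h; rfl

/-- The successive cyclic shifts on the whole tensor product. -/
def rotateTensor : (L D : List ℕ) → (tp hq (L ++ D)).V →ₗ[ℂ] (tp hq (D ++ L)).V
  | [], D => castTensor hq (by simp)
  | s :: L, D =>
    castTensor hq (by simp) ∘ₗ rotateTensor L (D ++ [s]) ∘ₗ
      castTensor hq (by simp) ∘ₗ cyclicShift hq s (L ++ D)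

/-- The two recursions run in parallel, and `S_val` matches them at each step. -/
theorem rotate_val : (L D : List ℕ) → (v : H hq (L ++ D)) →
    (rotate hq L D v).1 = rotateTensor hq L D v.1
  | [], D, v => castH_val hq _ v
  | s :: L, D, v => by
    refine (castH_val hq _ _).trans ?_
    refine (congrArg _ (rotate_val L (D ++ [s]) _)).trans ?_
    change castTensor hq _ (rotateTensor hq L (D ++ [s]) (castH hq _ (S hq s (L ++ D) v)).1) = _
    rw [castH_val, S_val]
    rfl

/-- Each moved factor contributes $-2(s_i-l_i)$ to the exponent; `D` and `ds` collect the factors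
already moved and their indices, and contribute nothing. -/
theorem rotateTensor_basisTensor : (L D ls ds : List ℕ) → ls.length = L.length →
    ds.length = D.length →
    rotateTensor hq L D (basisTensor hq (L ++ D) (ls ++ ds)) =
      q ^ (-2 * ((L.sum : ℤ) - (ls.sum : ℤ))) • basisTensor hq (D ++ L) (ds ++ ls)
  | [], D, [], ds, _, _ => by
    refine (castTensor_basisTensor hq _ _).trans ?_
    simp
  | s :: L, D, l :: ls, ds, hl, hd => by
    replace hl : ls.length = L.length := by simpa using hl
    change castTensor hq _ (rotateTensor hq L (D ++ [s]) (castTensor hq _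
      (cyclicShift hq s (L ++ D) (basisTensor hq (s :: (L ++ D)) (l :: (ls ++ ds)))))) = _
    -- After one shift `s` and `l` sit at the ends of `D` and `ds`, so the recursive call is made
    -- with `D ++ [s]` and `ds ++ [l]`.
    rw [cyclicShift_basisTensor hq s l (by simp [hl, hd]), map_smul, map_smul, map_smul,
      castTensor_basisTensor, List.append_assoc ls ds,
      rotateTensor_basisTensor L (D ++ [s]) ls (ds ++ [l]) hl (by simp [hd]), map_smul,
      castTensor_basisTensor, smul_smul, ← zpow_add₀ hq.1, List.append_assoc ds]
    congr 2
    push_cast [List.sum_cons]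
    ring

/-! ### The full rotation on invariant vectors -/

/-- The indices cancel: $-2(\sum s_i-\sum l_i)+(\sum s_i-2\sum l_i)=-\sum s_i$. The scalar is
therefore the same on every spanning vector, with no invariance assumed. -/
theorem K_rotateTensor (L : List ℕ) (v : (tp hq (L ++ [])).V) :
    (tp hq ([] ++ L)).K (rotateTensor hq L [] v) =
      q ^ (-(L.sum : ℤ)) • castTensor hq (by simp) v := by
  suffices h : (tp hq ([] ++ L)).K ∘ₗ rotateTensor hq L [] =
      q ^ (-(L.sum : ℤ)) • castTensor hq (by simp) from LinearMap.congr_fun h v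
  refine linearMap_ext_basisTensor hq fun ls hls => ?_
  replace hls : ls.length = L.length := by simpa using hls
  have h1 := rotateTensor_basisTensor hq L [] ls [] hls rfl
  rw [List.append_nil ls] at h1
  rw [LinearMap.comp_apply, h1, LinearMap.smul_apply, castTensor_basisTensor, map_smul,
    List.nil_append ls, K_basisTensor hq ([] ++ L) ls (by simpa using hls), smul_smul,
    ← zpow_add₀ hq.1]
  congr 2
  rw [List.nil_append]
  ring

theorem castTensor_castTensor {L L' L'' : List ℕ} (h : L = L') (h' : L' = L'')
    (v : (tp hq L).V) :
    castTensor hq h' (castTensor hq h v) = castTensor hq (h.trans h') v := by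
  subst h h'; rfl

/-- For an even total the two scalars coincide; for an odd total the vector is zero. -/
theorem neg_zpow_smul_of_mem_HW {L : List ℕ} {v : (tp hq L).V} (hv : v ∈ (tp hq L).HW 0) :
    q ^ (-(L.sum : ℤ)) • v = (-q) ^ (-(L.sum : ℤ)) • v := by
  by_cases hL : Even L.sum
  · have h : Even (-(L.sum : ℤ)) := ((Int.even_coe_nat _).mpr hL).neg
    rw [h.neg_zpow]
  · simp [eq_zero_of_odd_sum hq hL hv]

theorem rotate_castH (L : List ℕ) (h : L = L ++ []) (v : H hq L) :
    rotate hq L [] (castH hq h v) = (-q) ^ (-(L.sum : ℤ)) • v := by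
  refine Subtype.ext ?_
  -- The rotated vector is again invariant, so $K$ can be applied to it at no cost, which brings
  -- `K_rotateTensor` into play.
  have hK : (tp hq ([] ++ L)).K (rotate hq L [] (castH hq h v)).1 =
      (rotate hq L [] (castH hq h v)).1 := by
    simpa using ((UqRep.mem_HW _).mp (rotate hq L [] (castH hq h v)).2).2
  rw [← hK, rotate_val, K_rotateTensor, castH_val, castTensor_castTensor]
  exact neg_zpow_smul_of_mem_HW hq v.2

end rotation

end

end QuantumSl2

/-- The composition `S^(s_1) ∘ ⋯ ∘ S^(s_p)` of the cyclic permutation maps on `H_ς^(0)` is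
`∏_i (-q)^(-s_i)` times the identity. -/
theorem corollary4p3 {q : ℂ} (hq : QuantumSl2.Generic q) {p : ℕ} (ς : Fin p → ℕ) :
    QuantumSl2.cyclicComposition hq ς =
      (∏ i, (-q) ^ (-(ς i : ℤ))) •
        (LinearMap.id : QuantumSl2.InvariantSpace hq ς →ₗ[ℂ] QuantumSl2.InvariantSpace hq ς) := by
  refine LinearMap.ext fun v => ?_
  refine (QuantumSl2.rotate_castH hq _ _ v).trans ?_
  -- The factors are listed as $(s_p,\ldots,s_1)$, but only the sum of the list enters the scalar.
  rw [List.sum_reverse, List.sum_ofFn, LinearMap.smul_apply, LinearMap.id_apply]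
  congr 1
  simp only [zpow_neg, zpow_natCast, Finset.prod_inv_distrib, Finset.prod_pow_eq_pow_sum]
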